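/- Let an ordered generating system (OGS) of a group $G$ be a finite sequence $a_1,\dots,a_n\in G$ for which there are integers $m_1,\dots,m_n\ge 0$ such that every $g\in G$ has a unique representation $g=a_1^{i_1}a_2^{i_2}\cdots a_n^{i_n}$ with $0\le i_k\le m_k$ for $1\le k\le n$. Permutations are multiplied from left to right ($gh$ means first $g$, then $h$). The Mathieu groups $M_{24}$ and $M_{23}$ are the permutation automorphism groups of the extended binary Golay code of length 24 and of the binary Golay code of length 23. Theorem 7. The Mathieu group $M_{24}$ has an OGS. More precisely, let $G\le S_{24}$ be the group generated by $$D=(1,2,3,4,5,6,7,8,9,10,11,12,13,14,15,16,17,18,19,20,21,22,23),$$ $$E=(3,17,10,7,9)(4,13,14,19,5)(8,18,11,12,23)(15,20,22,21,16),$$ $$F=(1,24)(2,23)(3,12)(4,16)(5,18)(6,10)(7,20)(8,14)(9,21)(11,17)(13,22)(15,19),$$ let $H$ be the stabilizer of the point $24$ in $G$, and let $X_1=D^{-1}FD$ and $X_2=D^3F$. Then: 1. $G\cong M_{24}$ and $H\cong M_{23}$. 2. $X_1=(2,24)(1,3)(4,13)(5,17)(6,19)(7,11)(8,21)(9,15)(10,22)(12,18)(14,23)(16,20)$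 and $X_2=(1,16,15,5,14,11,8,17,7,6,21,24)(2,18,9,3,10,22,23,12,19,13,4,20)$. 3. The 24 products $X_1^iX_2^j$ with $0\le i<2$, $0\le j<12$ take the point $24$ to the 24 different points. 4. $H$ has an OGS, and whenever $a_1,\dots,a_n$ is an OGS of $H$ with exponent bounds $m_1,\dots,m_n$, the sequence $a_1,\dots,a_n,X_1,X_2$ is an OGS of $G$ with exponent bounds $m_1,\dots,m_n,1,11$. -/

import Mathlib

/-- `a₁, …, aₙ` is an ordered generating system of the group `G` with exponent bounds
`m₁, …, mₙ`: every `g : G` is `a₁ ^ i₁ * ⋯ * aₙ ^ iₙ` for exactly one tuple of exponents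
with `0 ≤ iₖ ≤ mₖ`. -/
def IsOGSWith {G : Type*} [Group G] {n : ℕ} (a : Fin n → G) (m : Fin n → ℕ) : Prop :=
  ∀ g : G, ∃! i : Fin n → ℕ,
    (∀ k, i k ≤ m k) ∧ g = (List.ofFn fun k => a k ^ i k).prod

/-- The group `G` has an ordered generating system. -/
def HasOGS (G : Type*) [Group G] : Prop :=
  ∃ (n : ℕ) (a : Fin n → G) (m : Fin n → ℕ), IsOGSWith a m

/-- The permutation automorphism group of a set `C` of words indexed by `X`. -/
def permAut {X R : Type*} (C : Set (X → R)) : Subgroup (Equiv.Perm X) where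
  carrier := {σ | ∀ c : X → R, c ∘ σ ∈ C ↔ c ∈ C}
  one_mem' := fun _ => Iff.rfl
  mul_mem' := fun {σ τ} hσ hτ c => (hτ (c ∘ σ)).trans (hσ c)
  inv_mem' := fun {σ} hσ c => by
    have h := hσ (c ∘ ⇑σ⁻¹)
    have e : (c ∘ ⇑σ⁻¹) ∘ ⇑σ = c := by
      funext x
      simp
    rw [e] at h
    exact h.symm

/-- The binary Golay code of length 23, as a quadratic residue code: the span over the field
with two elements of the 23 cyclic shifts of the indicator word of the quadratic nonresidues
modulo 23. -/
def golay23 : Submodule (ZMod 2) (ZMod 23 → ZMod 2) :=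
  Submodule.span (ZMod 2)
    (Set.range fun t : ZMod 23 => fun x : ZMod 23 => if IsSquare (x - t) then 0 else 1)

/-- The extended binary Golay code of length 24: the words of the Golay code of length 23,
with an overall parity check at the extra coordinate `none`. -/
def golay24 : Set (Option (ZMod 23) → ZMod 2) :=
  {c | (fun x : ZMod 23 => c (some x)) ∈ golay23 ∧ ∑ x, c x = 0}

/-- The Mathieu group `M₂₃`: the automorphism group of the binary Golay code. -/
abbrev M23 : Subgroup (Equiv.Perm (ZMod 23)) :=
  permAut (golay23 : Set (ZMod 23 → ZMod 2))

/-- The Mathieu group `M₂₄`: the automorphism group of the extended binary Golay code. -/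
abbrev M24 : Subgroup (Equiv.Perm (Option (ZMod 23))) :=
  permAut golay24

/-- The symmetric group on the points `1, …, 24`, a product `g * h` meaning first `g`, then `h`
(hence the opposite of `Equiv.Perm`, whose product is composition of functions). The points are
the elements of `Fin 24`, in which the numeral `24` denotes the element `0`. -/
abbrev S24 : Type := (Equiv.Perm (Fin 24))ᵐᵒᵖ

/-- The product of the cycles in a list; each cycle `[x₁, …, xᵣ]` maps `x₁` to `x₂`, and so on,
and `xᵣ` to `x₁`. -/
def ofCycles (l : List (List (Fin 24))) : S24 :=
  (l.map fun c => MulOpposite.op c.formPerm).prod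

/-- The image `p ^ g` of the point `p` under `g`. -/
def S24.image (g : S24) (p : Fin 24) : Fin 24 := g.unop p

/-- First generator. -/
def genD : S24 :=
  ofCycles [[1, 2, 3, 4, 5, 6, 7, 8, 9, 10, 11, 12, 13, 14, 15, 16, 17, 18, 19, 20, 21, 22, 23]]

/-- Second generator. -/
def genE : S24 :=
  ofCycles [[3, 17, 10, 7, 9], [4, 13, 14, 19, 5], [8, 18, 11, 12, 23], [15, 20, 22, 21, 16]]

/-- Third generator. -/
def genF : S24 :=
  ofCycles [[1, 24], [2, 23], [3, 12], [4, 16], [5, 18], [6, 10], [7, 20], [8, 14], [9, 21],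
    [11, 17], [13, 22], [15, 19]]

/-- The subgroup of `S₂₄` generated by the three permutations. -/
def groupDEF : Subgroup S24 := Subgroup.closure {genD, genE, genF}

/-- The stabilizer of the point `24` in the group generated by the three permutations. -/
def stab24 : Subgroup groupDEF where
  carrier := {g | S24.image (g : S24) 24 = 24}
  one_mem' := rfl
  mul_mem' := fun {g h} hg hh => by
    change (h : S24).unop ((g : S24).unop 24) = 24
    rw [show (g : S24).unop 24 = 24 from hg]
    exact hh
  inv_mem' := fun {g} hg => by
    change ((g : S24).unop)⁻¹ 24 = 24
    exact Equiv.Perm.inv_eq_iff_eq.mpr (Eq.symm hg)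

/-- The first generator as an element of the generated group. -/
def elemD : groupDEF := ⟨genD, Subgroup.subset_closure (by simp)⟩

/-- The third generator as an element of the generated group. -/
def elemF : groupDEF := ⟨genF, Subgroup.subset_closure (by simp)⟩

/-- `X₁ = D⁻¹ F D`. -/
def elemX1 : groupDEF := elemD⁻¹ * elemF * elemD

/-- `X₂ = D³ F`. -/
def elemX2 : groupDEF := elemD ^ 3 * elemF

/-! Suppose the elements of a permutation group that take a point p into Δ are uniquely factorized.
If the sets Δx^j, 0 ≤ j ≤ r, are disjoint with union Δ', then appending x with bound r factorizes
the elements taking p into Δ', because the image of p determines j (`Factorizes.orbitStep`). From H,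
where p = 24 and Δ = {24}, X₁ leads to {24, 2}. The two 12-cycles of X₂ separate 24 from 2, so X₂
then leads to all 24 points.

It remains to factorize H and to identify G with the automorphism group of the extended Golay code.
The generators preserve the code, so G is contained in that group. For the converse, the code has
minimum weight 8, so octads sharing five points coincide, and an automorphism fixing five points of
an octad preserves it (`testBit_image_of_octad`). Hence only the identity fixes 24, 1, 2, 3, 4, 6, 5
(`eq_one_of_mem_codeAut`). Climbing the chain of pointwise stabilizers, words in D, E, F sweep out
each orbit (`hasFactorization_codeAut`). This factorizes the automorphisms fixing 24 by elements of
H, so they form H; with X₁ and X₂ every automorphism lies in G. -/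

/-! ### Ordered factorizations of subsets of a group -/

/-- The products `a₁ ^ i₁ * ⋯ * aₙ ^ iₙ` with `0 ≤ iₖ ≤ mₖ` lie in `A` and represent every element
of `A` exactly once. -/
def Factorizes {S : Type*} [Group S] (A : Set S) {n : ℕ} (a : Fin n → S) (m : Fin n → ℕ) : Prop :=
  (∀ i : Fin n → ℕ, (∀ k, i k ≤ m k) → (List.ofFn fun k => a k ^ i k).prod ∈ A) ∧
  ∀ g ∈ A, ∃! i : Fin n → ℕ, (∀ k, i k ≤ m k) ∧ g = (List.ofFn fun k => a k ^ i k).prod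

theorem factorizes_univ_iff {S : Type*} [Group S] {n : ℕ} {a : Fin n → S} {m : Fin n → ℕ} :
    Factorizes Set.univ a m ↔ IsOGSWith a m := by
  simp [Factorizes, IsOGSWith]

theorem factorizes_one {S : Type*} [Group S] (a : Fin 0 → S) (m : Fin 0 → ℕ) :
    Factorizes {1} a m := by
  refine ⟨fun i _ => by simp, fun g hg => ⟨fun _ => 0, ⟨fun k => k.elim0, by simpa using hg⟩,
    fun i _ => Subsingleton.elim _ _⟩⟩

theorem prod_ofFn_snoc {S : Type*} [Group S] {n : ℕ} (a : Fin n → S) (x : S) (i : Fin (n + 1) → ℕ) :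
    (List.ofFn fun k => (Fin.snoc a x : Fin (n + 1) → S) k ^ i k).prod =
      (List.ofFn fun k => a k ^ i k.castSucc).prod * x ^ i (Fin.last n) := by
  rw [List.ofFn_succ']
  simp

/-- The last exponent is forced by `hBA`; the remaining factor lies in `A`, where the other
exponents are already unique. -/
theorem Factorizes.snoc {S : Type*} [Group S] {A B : Set S} {n : ℕ} {a : Fin n → S}
    {m : Fin n → ℕ} (h : Factorizes A a m) (x : S) (r : ℕ)
    (hAB : ∀ g ∈ A, ∀ j ≤ r, g * x ^ j ∈ B)
    (hBA : ∀ g ∈ B, ∃! j, j ≤ r ∧ g * (x ^ j)⁻¹ ∈ A) :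
    Factorizes B (Fin.snoc a x : Fin (n + 1) → S) (Fin.snoc m r : Fin (n + 1) → ℕ) := by
  have bound : ∀ i : Fin (n + 1) → ℕ, (∀ k, i k ≤ (Fin.snoc m r : Fin (n + 1) → ℕ) k) ↔
      (∀ k : Fin n, i k.castSucc ≤ m k) ∧ i (Fin.last n) ≤ r := by
    intro i
    simp [Fin.forall_fin_succ']
  constructor
  · intro i hi
    rw [bound] at hi
    rw [prod_ofFn_snoc]
    exact hAB _ (h.1 _ hi.1) _ hi.2
  · intro g hg
    obtain ⟨j, ⟨hj, hjA⟩, hju⟩ := hBA g hg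
    obtain ⟨i, ⟨hi, hig⟩, hiu⟩ := h.2 _ hjA
    refine ⟨(Fin.snoc i j : Fin (n + 1) → ℕ), ⟨(bound _).2 (by simpa using ⟨hi, hj⟩), ?_⟩, ?_⟩
    · rw [prod_ofFn_snoc]
      simp [← hig]
    · rintro i' ⟨hi', hg'⟩
      rw [bound] at hi'
      rw [prod_ofFn_snoc] at hg'
      have e : g * (x ^ i' (Fin.last n))⁻¹ = (List.ofFn fun k => a k ^ i' k.castSucc).prod := by
        rw [hg']; group
      have h1 : i' (Fin.last n) = j := hju _ ⟨hi'.2, e ▸ h.1 _ hi'.1⟩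
      have h2 : (fun k : Fin n => i' k.castSucc) = i := hiu _ ⟨hi'.1, by rw [← h1, e]⟩
      funext k
      refine Fin.lastCases ?_ (fun k => ?_) k
      · simp [h1]
      · simp [← h2]

theorem append_pair_eq_snoc {α : Type*} {n : ℕ} (a : Fin n → α) (x y : α) :
    Fin.append a ![x, y] =
      (Fin.snoc (Fin.snoc a x : Fin (n + 1) → α) y : Fin (n + 1 + 1) → α) := by
  funext k
  refine Fin.lastCases ?_ (fun k => Fin.lastCases ?_ (fun k => ?_) k) k
  · have : Fin.last (n + 1) = Fin.natAdd n (1 : Fin 2) := rfl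
    rw [Fin.snoc_last, this, Fin.append_right]
    rfl
  · have : (Fin.last n).castSucc = Fin.natAdd n (0 : Fin 2) := rfl
    rw [Fin.snoc_castSucc, Fin.snoc_last, this, Fin.append_right]
    rfl
  · have : k.castSucc.castSucc = Fin.castAdd 2 k := rfl
    rw [Fin.snoc_castSucc, Fin.snoc_castSucc, this, Fin.append_left]

theorem IsOGSWith.map {G G' : Type*} [Group G] [Group G'] (e : G ≃* G') {n : ℕ} {a : Fin n → G}
    {m : Fin n → ℕ} (h : IsOGSWith a m) : IsOGSWith (fun k => e (a k)) m := by
  intro g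
  have key : ∀ i : Fin n → ℕ, g = (List.ofFn fun k => e (a k) ^ i k).prod ↔
      e.symm g = (List.ofFn fun k => a k ^ i k).prod := by
    intro i
    rw [MulEquiv.symm_apply_eq, map_list_prod, List.map_ofFn]
    simp [Function.comp_def]
  simpa only [key] using h (e.symm g)

theorem HasOGS.map {G G' : Type*} [Group G] [Group G'] (e : G ≃* G') (h : HasOGS G) :
    HasOGS G' :=
  let ⟨n, _, m, h⟩ := h
  ⟨n, _, m, h.map e⟩

/-- The subset `A` has an ordered factorization with factors from the subgroup `L`. -/
def HasFactorization {S : Type*} [Group S] (L : Subgroup S) (A : Set S) : Prop :=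
  ∃ (n : ℕ) (a : Fin n → S) (m : Fin n → ℕ), (∀ k, a k ∈ L) ∧ Factorizes A a m

/-- This turns a factorization into an upper bound: it is how automorphisms of the code are shown to
lie in the generated group. -/
theorem HasFactorization.subset {S : Type*} [Group S] {L : Subgroup S} {A : Set S}
    (h : HasFactorization L A) : A ⊆ L := by
  obtain ⟨n, a, m, ha, h⟩ := h
  intro g hg
  obtain ⟨i, ⟨-, rfl⟩, -⟩ := h.2 g hg
  refine L.list_prod_mem fun y hy => ?_
  obtain ⟨k, rfl⟩ := (List.mem_ofFn' _ _).1 hy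
  exact L.pow_mem (ha k) _

theorem HasFactorization.mono {S : Type*} [Group S] {L L' : Subgroup S} {A : Set S} (hL : L ≤ L')
    (h : HasFactorization L A) : HasFactorization L' A :=
  let ⟨n, a, m, ha, h⟩ := h
  ⟨n, a, m, fun k => hL (ha k), h⟩

theorem HasFactorization.hasOGS {S : Type*} [Group S] {L : Subgroup S}
    (h : HasFactorization L (L : Set S)) : HasOGS L := by
  obtain ⟨n, a, m, ha, h⟩ := h
  refine ⟨n, fun k => ⟨a k, ha k⟩, m, fun g => ?_⟩
  have key : ∀ i : Fin n → ℕ, g = (List.ofFn fun k => (⟨a k, ha k⟩ : L) ^ i k).prod ↔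
      (g : S) = (List.ofFn fun k => a k ^ i k).prod := by
    intro i
    rw [Subtype.ext_iff, ← L.coe_subtype, map_list_prod, List.map_ofFn]
    rfl
  simpa only [key] using h.2 g g.2

/-! ### Factorizing along the orbit of a point -/

theorem S24.image_mul (g h : S24) (p : Fin 24) : (g * h).image p = h.image (g.image p) := rfl

theorem S24.image_one (p : Fin 24) : (1 : S24).image p = p := rfl

theorem S24.image_inv_eq_iff (g : S24) {p q : Fin 24} : g⁻¹.image p = q ↔ p = g.image q :=
  Equiv.Perm.inv_eq_iff_eq

theorem S24.image_injective (g : S24) : Function.Injective g.image := g.unop.injective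

theorem S24.image_pow {g : S24} {f : Fin 24 → Fin 24} (hf : ∀ p, g.image p = f p) (j : ℕ)
    (p : Fin 24) : (g ^ j).image p = f^[j] p := by
  induction j with
  | zero => rfl
  | succ j ih => rw [pow_succ, S24.image_mul, ih, hf, Function.iterate_succ_apply']

/-- The set `Δ'` is the disjoint union of the images of `Δ` under `f ^ j` for `j ≤ r`. -/
def IsOrbitStep (f : Fin 24 → Fin 24) (r : ℕ) (Δ Δ' : List (Fin 24)) : Prop :=
  (∀ j ∈ List.range (r + 1), ∀ q ∈ Δ, f^[j] q ∈ Δ') ∧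
  (∀ q ∈ Δ', ∃ j ∈ List.range (r + 1), ∃ p ∈ Δ, f^[j] p = q) ∧
  ∀ j ∈ List.range (r + 1), ∀ j' ∈ List.range (r + 1), ∀ p ∈ Δ, ∀ p' ∈ Δ,
    f^[j] p = f^[j'] p' → j = j'

set_option synthInstance.maxSize 4000 in
set_option synthInstance.maxHeartbeats 400000 in
instance (f : Fin 24 → Fin 24) (r : ℕ) (Δ Δ' : List (Fin 24)) :
    Decidable (IsOrbitStep f r Δ Δ') := by
  unfold IsOrbitStep
  infer_instance

/-- The elements of a subgroup that take a given point to one of the points of a list. -/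
def movingInto {S : Type*} [Group S] (φ : S →* S24) (K : Subgroup S) (p : Fin 24)
    (Δ : List (Fin 24)) : Set S :=
  {g | g ∈ K ∧ (φ g).image p ∈ Δ}

theorem Factorizes.orbitStep {S : Type*} [Group S] {φ : S →* S24} {K : Subgroup S} {p : Fin 24}
    {Δ Δ' : List (Fin 24)} {n : ℕ} {a : Fin n → S} {m : Fin n → ℕ}
    (h : Factorizes (movingInto φ K p Δ) a m) {x : S} (hx : x ∈ K) {f : Fin 24 → Fin 24}
    (hf : ∀ q, (φ x).image q = f q) {r : ℕ} (hΔ : IsOrbitStep f r Δ Δ') :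
    Factorizes (movingInto φ K p Δ') (Fin.snoc a x : Fin (n + 1) → S)
      (Fin.snoc m r : Fin (n + 1) → ℕ) := by
  obtain ⟨h1, h2, h3⟩ := hΔ
  simp only [List.mem_range, Nat.lt_succ_iff] at h1 h2 h3
  refine h.snoc x r ?_ ?_
  · rintro g ⟨hg, hgp⟩ j hj
    refine ⟨K.mul_mem hg (K.pow_mem hx j), ?_⟩
    rw [map_mul, map_pow, S24.image_mul, S24.image_pow hf]
    exact h1 j hj _ hgp
  · rintro g ⟨hg, hgp⟩
    -- With products read from left to right, removing `x ^ j` on the right pulls the image of `p`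
    -- back along `f^[j]`.
    have key : ∀ j, g * (x ^ j)⁻¹ ∈ movingInto φ K p Δ ↔
        ∃ q ∈ Δ, f^[j] q = (φ g).image p := by
      intro j
      constructor
      · rintro ⟨-, hq⟩
        refine ⟨_, hq, ?_⟩
        rw [← S24.image_pow hf, ← map_pow, ← S24.image_mul, ← map_mul, inv_mul_cancel_right]
      · rintro ⟨q, hq, e⟩
        refine ⟨K.mul_mem hg (K.inv_mem (K.pow_mem hx j)), ?_⟩
        rw [map_mul, map_inv, S24.image_mul, ← e, map_pow, ← S24.image_pow hf,
          (S24.image_inv_eq_iff _).2 rfl]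
        exact hq
    simp only [key]
    obtain ⟨j, hj, q, hq, e⟩ := h2 _ hgp
    refine ⟨j, ⟨hj, q, hq, e⟩, ?_⟩
    rintro j' ⟨hj', q', hq', e'⟩
    exact h3 j' hj' j hj q' hq' q hq (e'.trans e.symm)

theorem HasFactorization.orbitStep {S : Type*} [Group S] {φ : S →* S24} {L K : Subgroup S}
    {p : Fin 24} {Δ Δ' : List (Fin 24)} (h : HasFactorization L (movingInto φ K p Δ)) {x : S}
    (hxL : x ∈ L) (hx : x ∈ K) {f : Fin 24 → Fin 24} (hf : ∀ q, (φ x).image q = f q) {r : ℕ}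
    (hΔ : IsOrbitStep f r Δ Δ') : HasFactorization L (movingInto φ K p Δ') := by
  obtain ⟨n, a, m, ha, h⟩ := h
  refine ⟨n + 1, _, _, fun k => ?_, h.orbitStep hx hf hΔ⟩
  refine Fin.lastCases ?_ (fun k => ?_) k
  · simpa using hxL
  · simpa using ha k

/-! ### The extended Golay code in coordinates `0, …, 23` -/

/-- The binary word of length `24` whose letters are the binary digits of a number. -/
def word (n : ℕ) : Fin 24 → ZMod 2 := fun x => if n.testBit x then 1 else 0

theorem word_zero : word 0 = 0 := by
  funext x
  simp [word]

theorem word_xor (a b : ℕ) : word (a ^^^ b) = word a + word b := by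
  funext x
  simp only [word, Nat.testBit_xor, Pi.add_apply]
  cases a.testBit x <;> cases b.testBit x <;> decide

/-- The sum (without carry) of the numbers in a list selected by the binary digits of `k`. -/
def xorSelect : List ℕ → ℕ → ℕ
  | [], _ => 0
  | g :: l, k => (if k % 2 = 1 then g else 0) ^^^ xorSelect l (k / 2)

/-- The binary linear code spanned by a list of words. -/
def spanWords (l : List ℕ) : Submodule (ZMod 2) (Fin 24 → ZMod 2) :=
  Submodule.span (ZMod 2) (word '' {n | n ∈ l})

theorem word_mem_spanWords {l : List ℕ} {n : ℕ} (h : n ∈ l) : word n ∈ spanWords l :=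
  Submodule.subset_span ⟨n, h, rfl⟩

theorem spanWords_mono {l l' : List ℕ} (h : l ⊆ l') : spanWords l ≤ spanWords l' :=
  Submodule.span_mono (Set.image_mono h)

theorem word_xorSelect_mem (l : List ℕ) (k : ℕ) : word (xorSelect l k) ∈ spanWords l := by
  induction l generalizing k with
  | nil => simp [xorSelect, word_zero]
  | cons g l ih =>
    rw [xorSelect, word_xor]
    refine add_mem ?_ (spanWords_mono (List.subset_cons_self g l) (ih _))
    split_ifs
    · exact word_mem_spanWords List.mem_cons_self
    · simp [word_zero]

/-- The coefficients of a linear combination over the field with two elements are the binary digits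
of `k`, so codewords can be enumerated by numbers. -/
theorem exists_word_xorSelect_eq {l : List ℕ} {c : Fin 24 → ZMod 2} (hc : c ∈ spanWords l) :
    ∃ k < 2 ^ l.length, word (xorSelect l k) = c := by
  induction l generalizing c with
  | nil =>
    refine ⟨0, by simp, ?_⟩
    have : c = 0 := by simpa [spanWords] using hc
    rw [this, xorSelect, word_zero]
  | cons g l ih =>
    have e : word '' {n | n ∈ g :: l} = insert (word g) (word '' {n | n ∈ l}) := by
      rw [← Set.image_insert_eq]
      congr 1
      ext n
      simp
    rw [spanWords, e, Submodule.mem_span_insert] at hc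
    obtain ⟨t, z, hz, rfl⟩ := hc
    obtain ⟨k, hk, rfl⟩ := ih hz
    obtain rfl | rfl : t = 0 ∨ t = 1 := by
      revert t
      decide
    · refine ⟨2 * k, by rw [List.length_cons, pow_succ]; omega, ?_⟩
      simp [xorSelect]
    · refine ⟨2 * k + 1, by rw [List.length_cons, pow_succ]; omega, ?_⟩
      have e1 : (2 * k + 1) % 2 = 1 := by omega
      have e2 : (2 * k + 1) / 2 = k := by omega
      simp [xorSelect, word_xor, e1, e2]

/-- The number of digits `1` among the last `m` binary digits of `n`. -/
def bitCount (n : ℕ) : ℕ → ℕ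
  | 0 => 0
  | m + 1 => (n.testBit m).toNat + bitCount n m

theorem bitCount_eq_card (n m : ℕ) :
    bitCount n m = (Finset.univ.filter fun x : Fin m => n.testBit x).card := by
  induction m with
  | zero => rfl
  | succ m ih =>
    rw [bitCount, ih, Finset.card_filter, Finset.card_filter, Fin.sum_univ_castSucc, add_comm]
    simp only [Fin.val_castSucc, Fin.val_last]
    congr 1
    by_cases h : n.testBit m <;> simp [h]

theorem word_ne_zero_iff {n : ℕ} {x : Fin 24} : word n x ≠ 0 ↔ n.testBit x := by
  simp [word]

/-- The cyclic shifts of the quadratic nonresidue word, with a parity check in front. -/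
def shiftMasks : List ℕ :=
  [16095553, 15413891, 14050567, 11323919, 5870623, 11741245, 6705275, 13410549, 10043883, 3310551,
    6621101, 13242201, 9707187, 2637159, 5274317, 10548633, 4320051, 8640101, 502987, 1005973,
    2011945, 4023889, 8047777]

/-- The first twelve of the cyclic shifts. -/
def basisMasks : List ℕ := shiftMasks.take 12

/-- The extended Golay code, as a code with coordinates in `Fin 24`. -/
def code : Submodule (ZMod 2) (Fin 24 → ZMod 2) := spanWords basisMasks

theorem code_eq_spanWords_shiftMasks : code = spanWords shiftMasks := by
  refine le_antisymm (spanWords_mono (List.take_subset 12 shiftMasks)) (Submodule.span_le.2 ?_)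
  rintro _ ⟨n, hn, rfl⟩
  -- The binary digits of a listed number select the basis words whose sum is the shift; the powers
  -- of two are the basis words themselves.
  have key : ∀ n ∈ shiftMasks, ∃ k ∈ [1, 2, 4, 8, 16, 32, 64, 128, 256, 512, 1024, 2048, 3877, 367,
      734, 1468, 2936, 2517, 3215, 1595, 3190, 1993, 3986], xorSelect basisMasks k = n := by
    decide +kernel
  obtain ⟨k, -, rfl⟩ := key n hn
  exact word_xorSelect_mem _ _

/-- Minimum weight 8, by enumerating all combinations of the twelve basis words. -/
theorem bitCount_xorSelect_basisMasks :
    ((List.range 4096).all fun k => bitCount (xorSelect basisMasks k) 24 == 0 ||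
      Nat.ble 8 (bitCount (xorSelect basisMasks k) 24)) = true := by
  decide +kernel

theorem eq_zero_of_mem_code {c : Fin 24 → ZMod 2} (hc : c ∈ code)
    (h : (Finset.univ.filter fun x => c x ≠ 0).card < 8) : c = 0 := by
  obtain ⟨k, hk, rfl⟩ := exists_word_xorSelect_eq hc
  have hk' := List.all_eq_true.1 bitCount_xorSelect_basisMasks k (List.mem_range.2 hk)
  simp only [word_ne_zero_iff] at h
  rw [← bitCount_eq_card] at h
  have h0 : bitCount (xorSelect basisMasks k) 24 = 0 := by
    simp only [Bool.or_eq_true, beq_iff_eq, Nat.ble_eq] at hk'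
    omega
  rw [bitCount_eq_card, Finset.card_eq_zero, Finset.filter_eq_empty_iff] at h0
  funext x
  by_contra hx
  exact h0 (Finset.mem_univ x) (word_ne_zero_iff.1 hx)

/-- The word with given first letter and given remaining letters. -/
def consWord (s : ZMod 2) (u : ZMod 23 → ZMod 2) : Fin 24 → ZMod 2 :=
  fun k => Fin.cases (motive := fun _ => ZMod 2) s u k

theorem consWord_add (s t : ZMod 2) (u v : ZMod 23 → ZMod 2) :
    consWord (s + t) (u + v) = consWord s u + consWord t v := by
  funext k
  refine Fin.cases ?_ (fun k => ?_) k <;> rfl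

theorem consWord_smul (a s : ZMod 2) (u : ZMod 23 → ZMod 2) :
    consWord (a * s) (a • u) = a • consWord s u := by
  funext k
  refine Fin.cases ?_ (fun k => ?_) k <;> rfl

theorem consWord_eq_comp_iff {s : ZMod 2} {u : ZMod 23 → ZMod 2} {c : Option (ZMod 23) → ZMod 2} :
    consWord s u = c ∘ finSuccEquiv 23 ↔ s = c none ∧ ∀ k, u k = c (some k) := by
  rw [funext_iff, Fin.forall_fin_succ]
  exact Iff.rfl

/-- Prefixing a word of length `23` with a parity check. -/
def parityExtend : (ZMod 23 → ZMod 2) →ₗ[ZMod 2] (Fin 24 → ZMod 2) where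
  toFun u := consWord (∑ x, u x) u
  map_add' u v := by
    rw [← consWord_add, ← Finset.sum_add_distrib]
    rfl
  map_smul' a u := by
    rw [RingHom.id_apply, ← consWord_smul, Finset.mul_sum]
    rfl

theorem exists_parityExtend_shift : ∀ t : ZMod 23, ∃ n ∈ shiftMasks,
    consWord (∑ x : ZMod 23, if IsSquare (x - t) then (0 : ZMod 2) else 1)
      (fun x : ZMod 23 => if IsSquare (x - t) then (0 : ZMod 2) else 1) = word n := by
  decide +kernel

theorem exists_shift_eq_word : ∀ n ∈ shiftMasks, ∃ t : ZMod 23,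
    consWord (∑ x : ZMod 23, if IsSquare (x - t) then (0 : ZMod 2) else 1)
      (fun x : ZMod 23 => if IsSquare (x - t) then (0 : ZMod 2) else 1) = word n := by
  decide +kernel

theorem map_parityExtend_golay23 : golay23.map parityExtend = code := by
  rw [golay23, Submodule.map_span, code_eq_spanWords_shiftMasks, spanWords]
  congr 1
  ext c
  constructor
  · rintro ⟨_, ⟨t, rfl⟩, rfl⟩
    obtain ⟨n, hn, e⟩ := exists_parityExtend_shift t
    exact ⟨n, hn, e.symm⟩
  · rintro ⟨n, hn, rfl⟩
    obtain ⟨t, e⟩ := exists_shift_eq_word n hn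
    exact ⟨_, ⟨t, rfl⟩, e⟩

/-- The coordinate `0` (called `24`) is the extra coordinate of the extended code. -/
def coordEquiv : Fin 24 ≃ Option (ZMod 23) := finSuccEquiv 23

/-- In characteristic two, total sum zero means that the extra letter equals the sum of the others,
so `c` is the parity extension of its restriction. -/
theorem mem_golay24_iff (c : Option (ZMod 23) → ZMod 2) : c ∈ golay24 ↔ c ∘ coordEquiv ∈ code := by
  have hsum : ∑ x, c x = c none + ∑ x : ZMod 23, c (some x) := Fintype.sum_option c
  have hext : ∀ u : ZMod 23 → ZMod 2, parityExtend u = c ∘ coordEquiv ↔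
      (fun x => c (some x)) = u ∧ ∑ x, c x = 0 := by
    intro u
    have h1 : parityExtend u = c ∘ coordEquiv ↔ ∑ x, u x = c none ∧ ∀ k, u k = c (some k) :=
      consWord_eq_comp_iff
    rw [h1, hsum, funext_iff]
    constructor
    · rintro ⟨h, h'⟩
      refine ⟨fun k => (h' k).symm, ?_⟩
      simp only [← h', h]
      exact CharTwo.add_self_eq_zero _
    · rintro ⟨h, h'⟩
      refine ⟨?_, fun k => (h k).symm⟩
      simp only [← h]
      exact (CharTwo.add_eq_zero.1 h').symm
  rw [← map_parityExtend_golay23]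
  constructor
  · rintro ⟨h1, h2⟩
    exact ⟨_, h1, (hext _).2 ⟨rfl, h2⟩⟩
  · rintro ⟨u, hu, e⟩
    obtain ⟨rfl, h2⟩ := (hext u).1 e
    exact ⟨hu, h2⟩

/-! ### The automorphism group of the code -/

/-- The automorphisms of the code that fix the points of a list, with the multiplication
of `S24`. -/
def codeAut (bs : List (Fin 24)) : Subgroup S24 where
  carrier := {g | g.unop ∈ permAut (code : Set (Fin 24 → ZMod 2)) ∧ ∀ b ∈ bs, g.image b = b}
  one_mem' := ⟨one_mem (permAut _), fun _ _ => rfl⟩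
  mul_mem' := fun {g h} hg hh => ⟨mul_mem (S := Subgroup _) hh.1 hg.1, fun b hb => by
    rw [S24.image_mul, hg.2 b hb, hh.2 b hb]⟩
  inv_mem' := fun {g} hg => ⟨inv_mem (S := Subgroup _) hg.1, fun b hb => by
    rw [S24.image_inv_eq_iff, hg.2 b hb]⟩

/-- Permuting coordinates is linear and injective, so by dimension it maps the code onto itself once
it maps it into itself. Checking a basis therefore suffices. -/
theorem permAut_code_of_basisMasks {σ : Equiv.Perm (Fin 24)}
    (h : ∀ n ∈ basisMasks, word n ∘ σ ∈ code) : σ ∈ permAut (code : Set (Fin 24 → ZMod 2)) := by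
  let T : (Fin 24 → ZMod 2) →ₗ[ZMod 2] (Fin 24 → ZMod 2) := LinearMap.funLeft _ _ σ
  have hle : code ≤ code.comap T := by
    conv_lhs => rw [code, spanWords]
    rw [Submodule.span_le]
    rintro _ ⟨n, hn, rfl⟩
    exact h n hn
  have hT : Function.Injective T := LinearMap.funLeft_injective_of_surjective _ _ _ σ.surjective
  have hmap : code.map T = code :=
    Submodule.eq_of_le_of_finrank_eq (Submodule.map_le_iff_le_comap.2 hle)
      (Submodule.equivMapOfInjective T hT code).finrank_eq.symm
  intro c
  refine ⟨fun hc => ?_, fun hc => hle hc⟩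
  have hc' : T c ∈ code.map T := by
    rw [hmap]
    exact hc
  obtain ⟨d, hd, e⟩ := hc'
  exact hT e ▸ hd

theorem mem_codeAut_of_xorSelect {g : S24} (ks : List ℕ)
    (h : ∀ n ∈ basisMasks, ∃ k ∈ ks, ∀ x, word n (g.image x) = word (xorSelect basisMasks k) x) :
    g ∈ codeAut [] := by
  refine ⟨permAut_code_of_basisMasks fun n hn => ?_, by simp⟩
  obtain ⟨k, -, e⟩ := h n hn
  have e' : word n ∘ g.unop = word (xorSelect basisMasks k) := funext e
  rw [e']
  exact word_xorSelect_mem _ _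

/-- An automorphism fixing at least five points of an octad leaves the octad invariant. -/
theorem testBit_image_of_octad {bs : List (Fin 24)} {g : S24} (hg : g ∈ codeAut bs) {n : ℕ}
    (hn : word n ∈ code) (h8 : bitCount n 24 = 8)
    (h5 : 5 ≤ (Finset.univ.filter fun x : Fin 24 => x ∈ bs ∧ n.testBit x).card) (x : Fin 24) :
    n.testBit (g.image x) = n.testBit x := by
  classical
  let A : Finset (Fin 24) := Finset.univ.filter fun x => n.testBit x
  let B : Finset (Fin 24) := Finset.univ.filter fun x => n.testBit (g.image x)
  let P : Finset (Fin 24) := Finset.univ.filter fun x => x ∈ bs ∧ n.testBit x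
  have hA : A.card = 8 := by rw [← bitCount_eq_card, h8]
  have hB : B.card = 8 := by
    rw [← hA]
    refine Finset.card_bij (fun x _ => g.image x) (fun x hx => ?_)
      (fun x _ y _ h => g.image_injective h) (fun y hy => ⟨g⁻¹.image y, ?_, ?_⟩)
    · simpa [A, B] using hx
    · simpa [A, B, ← S24.image_mul, S24.image_one] using hy
    · simp [← S24.image_mul, S24.image_one]
  have hPA : P ⊆ A := fun x hx => by
    simp only [P, Finset.mem_filter] at hx
    simp [A, hx.2.2]
  have hPB : P ⊆ B := fun x hx => by
    simp only [P, Finset.mem_filter] at hx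
    simp [B, hg.2 x hx.2.1, hx.2.2]
  -- The two octads share the at least five points of `P`, so their sum has weight at most 3 + 3 <
  -- 8.
  have hz : word n ∘ g.unop + word n = 0 := by
    refine eq_zero_of_mem_code (add_mem ((hg.1 _).2 hn) hn) ?_
    have hsub : (Finset.univ.filter fun x => (word n ∘ g.unop + word n) x ≠ 0) ⊆
        (A \ P) ∪ (B \ P) := by
      intro x hx
      have hx' : word n (g.image x) + word n x ≠ 0 := (Finset.mem_filter.1 hx).2
      by_cases hxP : x ∈ P
      · have h1 : n.testBit (g.image x) := by simpa [B] using hPB hxP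
        have h2 : n.testBit x := by simpa [A] using hPA hxP
        simp [word, h1, h2, CharTwo.add_self_eq_zero] at hx'
      · by_cases h1 : n.testBit (g.image x) <;> by_cases h2 : n.testBit x <;>
          simp_all [A, B, word]
    have c1 := Finset.card_le_card hsub
    have c2 := Finset.card_union_le (A \ P) (B \ P)
    have c3 := Finset.card_sdiff_add_card_eq_card hPA
    have c4 := Finset.card_sdiff_add_card_eq_card hPB
    have c5 : 5 ≤ P.card := h5
    omega
  have hx : word n (g.image x) = word n x := CharTwo.add_eq_zero.1 (congrFun hz x)
  rw [Bool.eq_iff_iff, ← word_ne_zero_iff, ← word_ne_zero_iff, hx]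

/-- Some octads. -/
def octadMasks : List ℕ :=
  [8536111, 548979, 6299757, 10551418, 295007, 590013, 1180025, 66407, 1573998, 10558]

theorem word_mem_code_of_mem_octadMasks {n : ℕ} (hn : n ∈ octadMasks) : word n ∈ code := by
  have key : ∀ n ∈ octadMasks, ∃ k ∈ [1426, 764, 1196, 1637, 2852, 2413, 3583, 1039, 2179, 3002],
      xorSelect basisMasks k = n := by
    decide +kernel
  obtain ⟨k, -, rfl⟩ := key n hn
  exact word_xorSelect_mem _ _

theorem bitCount_octadMasks : ∀ n ∈ octadMasks, bitCount n 24 = 8 := by decide +kernel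

theorem image_ne_of_mem {bs : List (Fin 24)} {g : S24} (hg : g ∈ codeAut bs) {p : Fin 24}
    (hp : p ∉ bs) : g.image p ∉ bs := fun h =>
  hp (g.image_injective (hg.2 _ h) ▸ h)

theorem eq_one_of_mem_codeAut {g : S24} (hg : g ∈ codeAut [0, 1, 2, 3, 4, 6, 5]) : g = 1 := by
  have hinv : ∀ n ∈ octadMasks, ∀ x, n.testBit (g.image x) = n.testBit x := fun n hn x =>
    testBit_image_of_octad hg (word_mem_code_of_mem_octadMasks hn) (bitCount_octadMasks n hn)
      ((by decide +kernel : ∀ n ∈ octadMasks, 5 ≤ (Finset.univ.filter fun x : Fin 24 =>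
        x ∈ [0, 1, 2, 3, 4, 6, 5] ∧ n.testBit x).card) n hn) x
  -- Apart from the seven fixed points, the listed octads distinguish every point except 15 and 18
  -- from all others.
  have hsep : ∀ y x : Fin 24, x ∉ [0, 1, 2, 3, 4, 6, 5, 15, 18] →
      (∀ n ∈ octadMasks, n.testBit y = n.testBit x) → y ∉ [0, 1, 2, 3, 4, 6, 5] → y = x := by
    decide +kernel
  have hfix : ∀ b : Fin 24, b ∉ [15, 18] → g.image b = b := by
    intro b hb
    by_cases h : b ∈ [0, 1, 2, 3, 4, 6, 5]
    · exact hg.2 b h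
    · refine hsep _ _ ?_ (fun n hn => hinv n hn b) (image_ne_of_mem hg h)
      revert b
      decide
  let bs : List (Fin 24) := (List.finRange 24).filter fun b => b ∉ [15, 18]
  have hg' : g ∈ codeAut bs := ⟨hg.1, fun b hb => hfix b (by simpa using (List.mem_filter.1 hb).2)⟩
  -- This octad contains 15 but not 18, and its other seven points are now known to be fixed.
  have hinv' : ∀ x, (9691140).testBit (g.image x).1 = (9691140).testBit x.1 := by
    refine testBit_image_of_octad hg' ?_ (by decide +kernel) (by decide +kernel)
    have e : xorSelect basisMasks 3067 = 9691140 := by decide +kernel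
    rw [← e]
    exact word_xorSelect_mem _ _
  have hfix' : ∀ b, g.image b = b := by
    intro b
    by_cases h : b ∈ [15, 18]
    · have key : ∀ b ∈ [15, 18], ∀ y : Fin 24, y ∉ bs →
          (9691140).testBit y.1 = (9691140).testBit b.1 → y = b := by
        decide +kernel
      refine key b h _ (image_ne_of_mem hg' ?_) (hinv' b)
      revert b
      decide +kernel
    · exact hfix b h
  exact MulOpposite.unop_injective (Equiv.ext hfix')

/-! ### The generators as automorphisms -/

/-- The images of the points under the generator `D`. -/
def tableD : Fin 24 → Fin 24 :=
  ![0, 2, 3, 4, 5, 6, 7, 8, 9, 10, 11, 12, 13, 14, 15, 16, 17, 18, 19, 20, 21, 22, 23, 1]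

/-- The images of the points under the generator `E`. -/
def tableE : Fin 24 → Fin 24 :=
  ![0, 1, 2, 17, 13, 4, 6, 9, 18, 3, 7, 12, 23, 14, 19, 20, 15, 10, 11, 5, 22, 16, 21, 8]

/-- The images of the points under the generator `F`. -/
def tableF : Fin 24 → Fin 24 :=
  ![1, 0, 23, 12, 16, 18, 10, 20, 14, 21, 6, 17, 3, 22, 8, 19, 4, 11, 5, 15, 7, 9, 13, 2]

/-- The images of the points under the inverse of the generator `D`. -/
def tableDInv : Fin 24 → Fin 24 :=
  ![0, 23, 1, 2, 3, 4, 5, 6, 7, 8, 9, 10, 11, 12, 13, 14, 15, 16, 17, 18, 19, 20, 21, 22]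

/-- The images of the points under the inverse of the generator `E`. -/
def tableEInv : Fin 24 → Fin 24 :=
  ![0, 1, 2, 9, 5, 19, 6, 10, 23, 7, 17, 18, 11, 4, 13, 16, 21, 3, 8, 14, 15, 22, 20, 12]

theorem image_genD : ∀ p, genD.image p = tableD p := by decide +kernel

theorem image_genE : ∀ p, genE.image p = tableE p := by decide +kernel

theorem image_genF : ∀ p, genF.image p = tableF p := by decide +kernel

theorem image_genD_inv (p : Fin 24) : genD⁻¹.image p = tableDInv p := by
  rw [S24.image_inv_eq_iff, image_genD]
  revert p
  decide +kernel

theorem image_genE_inv (p : Fin 24) : genE⁻¹.image p = tableEInv p := by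
  rw [S24.image_inv_eq_iff, image_genE]
  revert p
  decide +kernel

theorem genD_mem_codeAut : genD ∈ codeAut [] := by
  -- `D` turns each cyclic shift into its predecessor; the first becomes the last, which has digits
  -- 3986.
  refine mem_codeAut_of_xorSelect [3986, 1, 2, 4, 8, 16, 32, 64, 128, 256, 512, 1024] ?_
  simp only [image_genD]
  decide +kernel

theorem genE_mem_codeAut : genE ∈ codeAut [] := by
  refine mem_codeAut_of_xorSelect
    [1, 678, 1957, 3113, 555, 1317, 2029, 1245, 2270, 3406, 1571, 799] ?_
  simp only [image_genE]
  decide +kernel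

theorem genF_mem_codeAut : genF ∈ codeAut [] := by
  refine mem_codeAut_of_xorSelect
    [2786, 1392, 738, 3934, 823, 513, 3289, 366, 1684, 2754, 2937, 5] ?_
  simp only [image_genF]
  decide +kernel

theorem groupDEF_le_codeAut : groupDEF ≤ codeAut [] := by
  rw [groupDEF, Subgroup.closure_le]
  rintro _ (rfl | rfl | rfl)
  exacts [genD_mem_codeAut, genE_mem_codeAut, genF_mem_codeAut]

/-- The letters of words in the generators. -/
inductive Letter
  | D | E | F | DInv | EInv

/-- The group element denoted by a letter. -/
def Letter.eval : Letter → S24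
  | .D => genD
  | .E => genE
  | .F => genF
  | .DInv => genD⁻¹
  | .EInv => genE⁻¹

/-- The permutation denoted by a letter. -/
def Letter.table : Letter → Fin 24 → Fin 24
  | .D => tableD
  | .E => tableE
  | .F => tableF
  | .DInv => tableDInv
  | .EInv => tableEInv

theorem Letter.image_eval (l : Letter) (p : Fin 24) : l.eval.image p = l.table p := by
  cases l
  exacts [image_genD p, image_genE p, image_genF p, image_genD_inv p, image_genE_inv p]

theorem Letter.eval_mem (l : Letter) : l.eval ∈ groupDEF := by
  have hD : genD ∈ groupDEF := elemD.2
  have hE : genE ∈ groupDEF := Subgroup.subset_closure (by simp)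
  have hF : genF ∈ groupDEF := elemF.2
  cases l
  exacts [hD, hE, hF, inv_mem hD, inv_mem hE]

/-- The group element denoted by a list of letters. -/
def evalLetters (w : List Letter) : S24 := (w.map Letter.eval).prod

/-- The image of a point under a list of letters. -/
def traceLetters (w : List Letter) (p : Fin 24) : Fin 24 := w.foldl (fun q l => l.table q) p

theorem image_evalLetters (w : List Letter) (p : Fin 24) :
    (evalLetters w).image p = traceLetters w p := by
  induction w generalizing p with
  | nil => rfl
  | cons l w ih =>
    have e : evalLetters (l :: w) = l.eval * evalLetters w := List.prod_cons
    rw [e, S24.image_mul, ih, l.image_eval]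
    rfl

theorem evalLetters_mem (w : List Letter) : evalLetters w ∈ groupDEF := by
  refine groupDEF.list_prod_mem fun g hg => ?_
  obtain ⟨l, -, rfl⟩ := List.mem_map.1 hg
  exact l.eval_mem

/-! ### Factorizing the automorphism group along a chain of point stabilizers -/

/-- The stabilizer of the point `24` in the generated group, as a group of permutations. -/
def stabSubgroup : Subgroup S24 := stab24.map groupDEF.subtype

theorem mem_stabSubgroup {g : S24} : g ∈ stabSubgroup ↔ g ∈ groupDEF ∧ g.image 0 = 0 := by
  constructor
  · rintro ⟨h, hh, rfl⟩
    exact ⟨h.2, hh⟩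
  · rintro ⟨h1, h2⟩
    exact ⟨⟨g, h1⟩, h2, rfl⟩

/-- Elements fixing the points of a list and moving a further point into a list. -/
abbrev codeAutInto (bs : List (Fin 24)) (p : Fin 24) (Δ : List (Fin 24)) : Set S24 :=
  movingInto (MonoidHom.id S24) (codeAut bs) p Δ

theorem HasFactorization.letterStep {bs : List (Fin 24)} {p : Fin 24} {Δ : List (Fin 24)}
    (h : HasFactorization stabSubgroup (codeAutInto bs p Δ)) (w : List Letter) (r : ℕ)
    (Δ' : List (Fin 24))
    (hw : (∀ b ∈ 0 :: bs, traceLetters w b = b) ∧ IsOrbitStep (traceLetters w) r Δ Δ') :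
    HasFactorization stabSubgroup (codeAutInto bs p Δ') := by
  refine h.orbitStep (x := evalLetters w) ?_ ⟨(groupDEF_le_codeAut (evalLetters_mem w)).1, ?_⟩
    (fun q => image_evalLetters w q) hw.2
  · refine mem_stabSubgroup.2 ⟨evalLetters_mem w, ?_⟩
    rw [image_evalLetters]
    exact hw.1 0 List.mem_cons_self
  · intro b hb
    rw [image_evalLetters]
    exact hw.1 b (List.mem_cons_of_mem _ hb)

theorem codeAut_append_eq (bs : List (Fin 24)) (p : Fin 24) :
    (codeAut (bs ++ [p]) : Set S24) = codeAutInto bs p [p] := by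
  ext g
  constructor
  · intro hg
    exact ⟨⟨hg.1, fun b hb => hg.2 b (List.mem_append_left _ hb)⟩,
      List.mem_singleton.2 (hg.2 p (by simp))⟩
  · rintro ⟨hg, hp⟩
    refine ⟨hg.1, fun b hb => ?_⟩
    rcases List.mem_append.1 hb with hb | hb
    · exact hg.2 b hb
    · rw [List.mem_singleton.1 hb]
      exact List.mem_singleton.1 hp

theorem codeAutInto_eq {bs : List (Fin 24)} {p : Fin 24} {Δ : List (Fin 24)}
    (h : ∀ g ∈ codeAut bs, g.image p ∈ Δ) : codeAutInto bs p Δ = codeAut bs :=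
  Set.ext fun _ => ⟨fun hg => hg.1, fun hg => ⟨hg, h _ hg⟩⟩

theorem codeAutInto_eq_of_forall {bs : List (Fin 24)} {p : Fin 24} {Δ : List (Fin 24)}
    (h : p ∉ bs ∧ ∀ q, q ∉ bs → q ∈ Δ) : codeAutInto bs p Δ = codeAut bs :=
  codeAutInto_eq fun _ hg => h.2 _ (image_ne_of_mem hg h.1)

theorem testBit_image_octad {bs : List (Fin 24)} (hbs : [0, 1, 2, 3, 4] ⊆ bs) {g : S24}
    (hg : g ∈ codeAut bs) (x : Fin 24) :
    (295007).testBit (g.image x).1 = (295007).testBit x.1 := by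
  have hg' : g ∈ codeAut [0, 1, 2, 3, 4] := ⟨hg.1, fun b hb => hg.2 b (hbs hb)⟩
  exact testBit_image_of_octad hg' (word_mem_code_of_mem_octadMasks (by decide))
    (bitCount_octadMasks _ (by decide)) (by decide +kernel) x

theorem HasFactorization.codeAutInto_of_append {L : Subgroup S24} {bs : List (Fin 24)} {p : Fin 24}
    (h : HasFactorization L (codeAut (bs ++ [p]) : Set S24)) :
    HasFactorization L (codeAutInto bs p [p]) :=
  codeAut_append_eq bs p ▸ h

/-- At each level, words fixing the earlier base points sweep out an orbit from a single point, and
an upper bound on the orbit shows that nothing is missed. The orbit lengths from the bottom are 16,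
3, 20, 21, 22, 23. -/
theorem hasFactorization_codeAut : HasFactorization stabSubgroup (codeAut [0] : Set S24) := by
  have h : HasFactorization stabSubgroup (codeAut [0, 1, 2, 3, 4, 6, 5] : Set S24) := by
    have e : (codeAut [0, 1, 2, 3, 4, 6, 5] : Set S24) = {1} :=
      Set.ext fun g => ⟨eq_one_of_mem_codeAut, fun hg => Set.mem_singleton_iff.1 hg ▸ one_mem _⟩
    rw [e]
    exact ⟨0, Fin.elim0, Fin.elim0, fun k => k.elim0, factorizes_one _ _⟩
  replace h := h.codeAutInto_of_append (bs := [0, 1, 2, 3, 4, 6]) (p := 5)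
  replace h := h.letterStep [.DInv, .EInv, .D, .EInv, .DInv, .DInv, .DInv, .E, .E, .D, .EInv, .DInv, .E] 1
    [5, 10] (by decide +kernel)
  replace h := h.letterStep [.EInv, .DInv, .DInv, .EInv, .DInv, .E, .DInv, .DInv, .DInv, .E, .DInv, .E, .E] 1
    [5, 10, 17, 21] (by decide +kernel)
  replace h := h.letterStep [.DInv, .EInv, .EInv, .DInv, .DInv, .E, .D, .EInv, .D, .EInv, .D, .D, .EInv, .D] 1
    [5, 7, 9, 10, 13, 17, 21, 22] (by decide +kernel)
  replace h := h.letterStep [.E, .D, .D, .E, .DInv, .DInv, .EInv, .EInv, .D, .EInv, .D, .EInv, .D, .D] 1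
    [5, 7, 8, 9, 10, 11, 12, 13, 14, 16, 17, 19, 20, 21, 22, 23] (by decide +kernel)
  -- The octad 295007 is {0, 1, 2, 3, 4, 6, 15, 18}. It is invariant and misses 5, so 5 can only
  -- move among the 16 points outside it.
  rw [codeAutInto_eq fun g hg => (by decide +kernel :
    ∀ y : Fin 24, (295007).testBit y.1 = (295007).testBit (5 : Fin 24).1 →
      y ∉ [0, 1, 2, 3, 4, 6] → y ∈ [5, 7, 8, 9, 10, 11, 12, 13, 14, 16, 17, 19, 20, 21, 22, 23]) _ (testBit_image_octad (by decide) hg 5)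
        (image_ne_of_mem hg (by decide))] at h
  replace h := h.codeAutInto_of_append (bs := [0, 1, 2, 3, 4]) (p := 6)
  replace h := h.letterStep [.D, .D, .EInv, .D, .D, .EInv, .D, .D, .E, .D, .D] 2
    [6, 15, 18] (by decide +kernel)
  -- Here 6 must stay in the same octad, outside the five fixed points.
  rw [codeAutInto_eq fun g hg => (by decide +kernel :
    ∀ y : Fin 24, (295007).testBit y.1 = (295007).testBit (6 : Fin 24).1 →
      y ∉ [0, 1, 2, 3, 4] → y ∈ [6, 15, 18]) _ (testBit_image_octad (by decide) hg 6)
        (image_ne_of_mem hg (by decide))] at h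
  replace h := h.codeAutInto_of_append (bs := [0, 1, 2, 3]) (p := 4)
  replace h := h.letterStep [.D, .F, .E, .E, .F, .E, .DInv, .DInv, .EInv, .DInv, .E] 3
    [4, 15, 20, 22] (by decide +kernel)
  replace h := h.letterStep [.E, .F, .D, .EInv, .F, .D, .EInv, .EInv, .F, .D] 4
    [4, 5, 6, 7, 8, 9, 10, 11, 12, 13, 14, 15, 16, 17, 18, 19, 20, 21, 22, 23] (by decide +kernel)
  rw [codeAutInto_eq_of_forall (by decide +kernel)] at h
  replace h := h.codeAutInto_of_append (bs := [0, 1, 2]) (p := 3)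
  replace h := h.letterStep [.E] 2
    [3, 10, 17] (by decide +kernel)
  replace h := h.letterStep [.F, .D, .E, .DInv, .F, .EInv] 6
    [3, 4, 5, 6, 7, 8, 9, 10, 11, 12, 13, 14, 15, 16, 17, 18, 19, 20, 21, 22, 23] (by decide +kernel)
  rw [codeAutInto_eq_of_forall (by decide +kernel)] at h
  replace h := h.codeAutInto_of_append (bs := [0, 1]) (p := 2)
  replace h := h.letterStep [.D, .E, .DInv] 1
    [2, 16] (by decide +kernel)
  replace h := h.letterStep [.F, .E, .F, .EInv] 10
    [2, 3, 4, 5, 6, 7, 8, 9, 10, 11, 12, 13, 14, 15, 16, 17, 18, 19, 20, 21, 22, 23] (by decide +kernel)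
  rw [codeAutInto_eq_of_forall (by decide +kernel)] at h
  replace h := h.codeAutInto_of_append (bs := [0]) (p := 1)
  replace h := h.letterStep [.D] 22
    [1, 2, 3, 4, 5, 6, 7, 8, 9, 10, 11, 12, 13, 14, 15, 16, 17, 18, 19, 20, 21, 22, 23] (by decide +kernel)
  rw [codeAutInto_eq_of_forall (by decide +kernel)] at h
  exact h

/-! ### The top of the chain -/

theorem coe_elemX1 : (elemX1 : S24) = evalLetters [.DInv, .F, .D] := by
  simp [elemX1, elemD, elemF, evalLetters, Letter.eval, mul_assoc]

theorem coe_elemX2 : (elemX2 : S24) = evalLetters [.D, .D, .D, .F] := by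
  simp [elemX2, elemD, elemF, evalLetters, Letter.eval, mul_assoc, pow_succ]

theorem image_elemX1 (p : Fin 24) :
    S24.image (elemX1 : S24) p = traceLetters [.DInv, .F, .D] p := by
  rw [coe_elemX1, image_evalLetters]

theorem image_elemX2 (p : Fin 24) :
    S24.image (elemX2 : S24) p = traceLetters [.D, .D, .D, .F] p := by
  rw [coe_elemX2, image_evalLetters]

theorem isOrbitStep_elemX1 : IsOrbitStep (traceLetters [.DInv, .F, .D]) 1 [0] [0, 2] := by
  decide +kernel

theorem isOrbitStep_elemX2 :
    IsOrbitStep (traceLetters [.D, .D, .D, .F]) 11 [0, 2] (List.finRange 24) := by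
  decide +kernel

theorem isOGSWith_append {n : ℕ} {a : Fin n → stab24} {m : Fin n → ℕ} (h : IsOGSWith a m) :
    IsOGSWith (Fin.append (fun k => (a k : groupDEF)) ![elemX1, elemX2])
      (Fin.append m ![1, 11]) := by
  rw [← factorizes_univ_iff, append_pair_eq_snoc, append_pair_eq_snoc]
  have h0 : Factorizes (movingInto groupDEF.subtype ⊤ 0 [0]) (fun k => (a k : groupDEF)) m := by
    have hprod : ∀ i : Fin n → ℕ, (List.ofFn fun k => (a k : groupDEF) ^ i k).prod =
        ((List.ofFn fun k => a k ^ i k).prod : stab24) := by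
      intro i
      rw [← stab24.coe_subtype, map_list_prod, List.map_ofFn]
      rfl
    have hmem : ∀ g : groupDEF, g ∈ movingInto groupDEF.subtype ⊤ 0 [0] ↔ g ∈ stab24 := fun g =>
      ⟨fun hg => List.mem_singleton.1 hg.2, fun hg => ⟨trivial, List.mem_singleton.2 hg⟩⟩
    constructor
    · intro i _
      rw [hmem, hprod]
      exact SetLike.coe_mem _
    · intro g hg
      simp only [hprod]
      simpa only [Subtype.ext_iff] using h ⟨g, (hmem g).1 hg⟩
  have h2 := (h0.orbitStep (Subgroup.mem_top elemX1) image_elemX1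
    isOrbitStep_elemX1).orbitStep (Subgroup.mem_top elemX2) image_elemX2 isOrbitStep_elemX2
  have e : movingInto groupDEF.subtype ⊤ 0 (List.finRange 24) = Set.univ :=
    Set.eq_univ_of_forall fun g => ⟨trivial, List.mem_finRange _⟩
  rwa [e] at h2

theorem groupDEF_eq_codeAut : groupDEF = codeAut [] := by
  refine le_antisymm groupDEF_le_codeAut ?_
  have hL : stabSubgroup ≤ groupDEF := fun g hg => (mem_stabSubgroup.1 hg).1
  have h : HasFactorization groupDEF (codeAutInto [] 0 [0]) :=
    (hasFactorization_codeAut.mono hL).codeAutInto_of_append (bs := [])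
  have h2 := (h.orbitStep elemX1.2 (groupDEF_le_codeAut elemX1.2) image_elemX1
    isOrbitStep_elemX1).orbitStep elemX2.2 (groupDEF_le_codeAut elemX2.2) image_elemX2
    isOrbitStep_elemX2
  intro g hg
  exact h2.subset ⟨hg, List.mem_finRange _⟩

theorem stabSubgroup_eq_codeAut : stabSubgroup = codeAut [0] := by
  ext g
  rw [mem_stabSubgroup, groupDEF_eq_codeAut]
  constructor
  · rintro ⟨h1, h2⟩
    exact ⟨h1.1, by simpa using h2⟩
  · intro h
    exact ⟨⟨h.1, by simp⟩, h.2 0 (by simp)⟩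

theorem hasOGS_stab24 : HasOGS stab24 := by
  have h : HasFactorization stabSubgroup (stabSubgroup : Set S24) := by
    have := hasFactorization_codeAut
    rwa [← stabSubgroup_eq_codeAut] at this
  exact h.hasOGS.map
    (stab24.equivMapOfInjective groupDEF.subtype groupDEF.subtype_injective).symm

/-! ### Comparison with the Mathieu groups -/

/-- Renaming the points, and inverting to reverse the order of multiplication. -/
def permEquiv : Equiv.Perm (Option (ZMod 23)) ≃* S24 :=
  coordEquiv.symm.permCongrHom.trans (MulEquiv.inv' _)

theorem unop_permEquiv_inv (σ : Equiv.Perm (Option (ZMod 23))) :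
    (permEquiv σ).unop⁻¹ = coordEquiv.symm.permCongr σ := inv_inv _

/-- A subgroup is closed under inverses, so the inversion in `permEquiv` is harmless and only the
renaming of coordinates matters. -/
theorem permEquiv_mem_codeAut_iff {σ : Equiv.Perm (Option (ZMod 23))} :
    permEquiv σ ∈ codeAut [] ↔ σ ∈ M24 := by
  have h1 : permEquiv σ ∈ codeAut [] ↔
      (permEquiv σ).unop⁻¹ ∈ permAut (code : Set (Fin 24 → ZMod 2)) := by
    rw [inv_mem_iff]
    exact ⟨fun h => h.1, fun h => ⟨h, by simp⟩⟩
  rw [h1, unop_permEquiv_inv]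
  have hcomp : ∀ c : Option (ZMod 23) → ZMod 2,
      (c ∘ coordEquiv) ∘ coordEquiv.symm.permCongr σ = (c ∘ σ) ∘ coordEquiv := by
    intro c
    funext x
    simp [Equiv.permCongr_apply]
  constructor
  · intro h c
    rw [mem_golay24_iff, mem_golay24_iff, ← hcomp]
    exact h _
  · intro h c
    have hc : c = (c ∘ coordEquiv.symm) ∘ coordEquiv := by
      funext x
      simp
    rw [hc, hcomp]
    have := h (c ∘ coordEquiv.symm)
    rwa [mem_golay24_iff, mem_golay24_iff] at this

theorem map_permEquiv_M24 : M24.map permEquiv.toMonoidHom = groupDEF := by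
  rw [groupDEF_eq_codeAut]
  ext g
  obtain ⟨σ, rfl⟩ := permEquiv.surjective g
  rw [permEquiv_mem_codeAut_iff]
  exact Subgroup.mem_map_equiv.trans (by simp)

theorem nonempty_groupDEF_mulEquiv_M24 : Nonempty (groupDEF ≃* M24) := by
  have e := (permEquiv.subgroupMap M24).symm
  rw [show M24.map (permEquiv : _ →* S24) = groupDEF from map_permEquiv_M24] at e
  exact ⟨e⟩

/-- Extending a permutation by a fixed point. -/
def optionCongrHom (α : Type*) : Equiv.Perm α →* Equiv.Perm (Option α) where
  toFun := Equiv.optionCongr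
  map_one' := Equiv.optionCongr_one
  map_mul' σ τ := Equiv.optionCongr_trans τ σ

/-- A permutation preserves the total sum, and every word of length 23 extends by a parity letter,
so only the condition on `golay23` remains. -/
theorem optionCongr_mem_M24_iff {τ : Equiv.Perm (ZMod 23)} :
    optionCongrHom _ τ ∈ M24 ↔ τ ∈ M23 := by
  have key : ∀ c : Option (ZMod 23) → ZMod 2,
      c ∘ optionCongrHom _ τ ∈ golay24 ↔
        (fun x => c (some x)) ∘ τ ∈ golay23 ∧ ∑ x, c x = 0 := fun c =>
    and_congr Iff.rfl (by rw [← Equiv.sum_comp (optionCongrHom _ τ) c]; rfl)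
  constructor
  · intro h c
    let d : Option (ZMod 23) → ZMod 2 := fun x => x.elim (∑ x, c x) c
    have hd : ∑ x, d x = 0 := by
      rw [Fintype.sum_option]
      exact CharTwo.add_self_eq_zero _
    have hd' := (key d).symm.trans (h d)
    exact ⟨fun hc => (hd'.1 ⟨hc, hd⟩).1, fun hc => (hd'.2 ⟨hc, hd⟩).1⟩
  · intro h c
    rw [key]
    exact and_congr (h _) Iff.rfl

theorem map_optionCongrHom_M23 :
    M23.map (permEquiv.toMonoidHom.comp (optionCongrHom (ZMod 23))) = stabSubgroup := by
  ext g
  obtain ⟨σ, rfl⟩ := permEquiv.surjective g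
  have hfix : (permEquiv σ).image 0 = 0 ↔ σ none = none := by
    have h : (permEquiv σ).image 0 = 0 ↔ 0 = coordEquiv.symm (σ none) := Equiv.Perm.inv_eq_iff_eq
    rw [h, Equiv.eq_symm_apply]
    exact eq_comm
  rw [mem_stabSubgroup, groupDEF_eq_codeAut, permEquiv_mem_codeAut_iff, hfix]
  constructor
  · rintro ⟨τ, hτ, e⟩
    obtain rfl : optionCongrHom _ τ = σ := permEquiv.injective e
    exact ⟨optionCongr_mem_M24_iff.2 hτ, rfl⟩
  · rintro ⟨h, h0⟩
    -- The correcting transposition in `map_equiv_removeNone` exchanges `none` with its image, so it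
    -- is trivial here.
    have e : optionCongrHom _ (Equiv.removeNone σ) = σ := by
      refine (map_equiv_removeNone σ).trans ?_
      rw [h0, Equiv.swap_self]
      rfl
    exact ⟨Equiv.removeNone σ, optionCongr_mem_M24_iff.1 (e.symm ▸ h), congrArg permEquiv e⟩

theorem nonempty_stab24_mulEquiv_M23 : Nonempty (stab24 ≃* M23) := by
  have e1 : stab24 ≃* stabSubgroup :=
    stab24.equivMapOfInjective groupDEF.subtype groupDEF.subtype_injective
  have hinj : Function.Injective (permEquiv.toMonoidHom.comp (optionCongrHom (ZMod 23))) :=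
    permEquiv.injective.comp Equiv.optionCongr_injective
  have e2 := (M23.equivMapOfInjective _ hinj).symm
  rw [map_optionCongrHom_M23] at e2
  exact ⟨e1.trans e2⟩

theorem theorem7 :
    -- the Mathieu group has an ordered generating system
    HasOGS M24 ∧
    -- it is realized by the three permutations, with the point stabilizer isomorphic to `M₂₃`
    Nonempty (groupDEF ≃* M24) ∧
    Nonempty (stab24 ≃* M23) ∧
    -- the two explicit permutations in cycle notation
    (elemX1 : S24) = ofCycles
      [[2, 24], [1, 3], [4, 13], [5, 17], [6, 19], [7, 11], [8, 21], [9, 15], [10, 22],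
        [12, 18], [14, 23], [16, 20]] ∧
    (elemX2 : S24) = ofCycles
      [[1, 16, 15, 5, 14, 11, 8, 17, 7, 6, 21, 24], [2, 18, 9, 3, 10, 22, 23, 12, 19, 13, 4, 20]] ∧
    -- their products take the point `24` to all 24 points, each exactly once
    Function.Bijective (fun p : Fin 2 × Fin 12 =>
      S24.image (elemX1 ^ (p.1 : ℕ) * elemX2 ^ (p.2 : ℕ) : groupDEF) 24) ∧
    -- the stabilizer has an ordered generating system, and any such system, followed by
    -- `X₁`, `X₂` with exponents below 2 and 12, is an ordered generating system
    HasOGS stab24 ∧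
    ∀ (n : ℕ) (a : Fin n → stab24) (m : Fin n → ℕ), IsOGSWith a m →
      IsOGSWith (Fin.append (fun k => (a k : groupDEF)) ![elemX1, elemX2])
        (Fin.append m ![1, 11]) := by
  obtain ⟨e⟩ := nonempty_groupDEF_mulEquiv_M24
  obtain ⟨n, a, m, h⟩ := hasOGS_stab24
  have hG : HasOGS groupDEF := ⟨_, _, _, isOGSWith_append h⟩
  have htable : ∀ {g : S24} {w : List Letter} {l : List (List (Fin 24))}, g = evalLetters w →
      (∀ p, traceLetters w p = (ofCycles l).image p) → g = ofCycles l := by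
    rintro _ w l rfl h
    exact MulOpposite.unop_injective (Equiv.ext fun p => (image_evalLetters w p).trans (h p))
  refine ⟨hG.map e, ⟨e⟩, nonempty_stab24_mulEquiv_M23, htable coe_elemX1 (by decide +kernel),
    htable coe_elemX2 (by decide +kernel), ?_, hasOGS_stab24,
    fun n a m h => isOGSWith_append h⟩
  have key : (fun p : Fin 2 × Fin 12 =>
      S24.image (elemX1 ^ (p.1 : ℕ) * elemX2 ^ (p.2 : ℕ) : groupDEF) 24) =
      fun p : Fin 2 × Fin 12 => (traceLetters [.D, .D, .D, .F])^[(p.2 : ℕ)]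
        ((traceLetters [.DInv, .F, .D])^[(p.1 : ℕ)] 24) := by
    funext p
    rw [Subgroup.coe_mul, Subgroup.coe_pow, Subgroup.coe_pow, S24.image_mul,
      S24.image_pow image_elemX1, S24.image_pow image_elemX2]
  rw [key, Fintype.bijective_iff_injective_and_card]
  exact ⟨by decide +kernel, by simp⟩
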